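/- There is a universal constant $D>0$ with the following property. Let $X$ be a nonzero real Banach space with norm $\|\cdot\|$ and let $1<p\le 2$. For $\tau>0$ let $$\rho_X(\tau)=\sup\Big\{\tfrac{\|x+\tau y\|+\|x-\tau y\|}{2}-1 : x,y\in X,\ \|x\|=\|y\|=1\Big\}$$ be the modulus of uniform smoothness of $X$. Suppose that $X$ is $p$-uniformly smooth, i.e. there is $s>0$ with $\rho_X(\tau)\le s\tau^p$ for all $\tau>0$, and let $s_p(X)$ be the infimum of all such $s$. Then there is a constant $K$ depending only on $X$ and $p$, with $0<K\le D\,s_p(X)$ (that is, $K=O(s_p(X))$), such that the following holds. Let $(\Omega,\mathscr F,\mathbb P)$ be a probability space with a filtration $(\mathscr F_j)_{j\ge 0}$, let $f=(f_j)_{j\ge 0}$ be an $X$-valued (Bochner integrable) martingale relative to $(\mathscr F_j)_{j\ge0}$, and let $w=(w_j)_{j\ge 1}$ be a predictable sequence of real random variables (i.e. $w_j$ is $\mathscr F_{j-1}$-measurable for each $j\ge1$) with $w_j\ge 0$ and $\|f_j-f_{j-1}\|\le w_j$ almost surely for every $j\ge 1$. Put $f^*=\sup_{j\ge 1}\|f_j-f_0\|$.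 Then for all $r\ge 0$, $$\mathbb P\{f^*\ge r\}\le 2\exp\left(-\frac{r^p}{2K\,\big\|\sum_{j=1}^\infty w_j^p\big\|_\infty}\right).$$ Here $\|\cdot\|_\infty\in[0,\infty]$ is the essential supremum; if it is $\infty$, the fraction is read as $0$, and if it is $0$, the fraction is read as $\infty$ for $r>0$ (so the right side is $0$) and as $0$ for $r=0$. -/

import Mathlib

open MeasureTheory
open scoped ENNReal

universe u v

noncomputable section

/-- The modulus of uniform smoothness `ρ_X(τ)` of a normed space `X`: the supremum of
`(‖x + τ y‖ + ‖x - τ y‖) / 2 - 1` over unit vectors `x`, `y`. The set is bounded above by `|τ|`,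
and nonempty if `X ≠ {0}`, so the real supremum is a genuine one. -/
def smoothnessModulus (X : Type u) [NormedAddCommGroup X] [NormedSpace ℝ X] (τ : ℝ) : ℝ :=
  sSup {a : ℝ | ∃ x y : X, ‖x‖ = 1 ∧ ‖y‖ = 1 ∧ a = (‖x + τ • y‖ + ‖x - τ • y‖) / 2 - 1}

/-- The set of all `s > 0` with `ρ_X(τ) ≤ s τ ^ p` for every `τ > 0`. -/
def smoothnessBounds (X : Type u) [NormedAddCommGroup X] [NormedSpace ℝ X] (p : ℝ) : Set ℝ :=
  {s : ℝ | 0 < s ∧ ∀ τ : ℝ, 0 < τ → smoothnessModulus X τ ≤ s * τ ^ p}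

/-- `X` is `p`-uniformly smooth: `ρ_X(τ) ≤ s τ ^ p` for all `τ > 0`, with some constant `s > 0`. -/
def IsUniformlySmooth (X : Type u) [NormedAddCommGroup X] [NormedSpace ℝ X] (p : ℝ) : Prop :=
  (smoothnessBounds X p).Nonempty

/-- The `p`-uniform smoothness constant `s_p(X)`: the infimum of the constants `s > 0` with
`ρ_X(τ) ≤ s τ ^ p` for all `τ > 0`. -/
def smoothnessConstant (X : Type u) [NormedAddCommGroup X] [NormedSpace ℝ X] (p : ℝ) : ℝ :=
  sInf (smoothnessBounds X p)

/-- The sequence `w_1, w_2, …` is predictable: `w_j` is `ℱ_{j-1}`-measurable for every `j ≥ 1`.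
The entry `w 0` is not used. -/
def IsPredictableSeq {Ω : Type v} {m : MeasurableSpace Ω} (ℱ : Filtration ℕ m)
    (w : ℕ → Ω → ℝ) : Prop :=
  ∀ j : ℕ, Measurable[ℱ j] (w (j + 1))

/-- The maximal function `f^* = sup_{j ≥ 1} ‖f_j - f_0‖`, with values in `[0, ∞]`. -/
def maximalFn {Ω : Type v} {X : Type u} [NormedAddCommGroup X] (f : ℕ → Ω → X) (ω : Ω) : ℝ≥0∞ :=
  ⨆ j : ℕ, ‖f (j + 1) ω - f 0 ω‖ₑ

/-- The `L^∞` norm of `∑_{j ≥ 1} w_j ^ p`, with values in `[0, ∞]`. -/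
def powSumNorm {Ω : Type v} {m : MeasurableSpace Ω} (μ : Measure Ω) (p : ℝ)
    (w : ℕ → Ω → ℝ) : ℝ≥0∞ :=
  eLpNorm (fun ω => ∑' j : ℕ, ENNReal.ofReal (w (j + 1) ω) ^ p) ∞ μ

/-- The Azuma-type bound `2 exp (- r ^ p / (2 K b))` for `r ≥ 0`, `K > 0`, and `b` in `[0, ∞]`.
The quotient is formed in `[0, ∞]`, where `r ^ p / ∞ = 0`, `r ^ p / 0 = ∞` for `r > 0`, and
`0 / 0 = 0`; moreover `exp (-∞) = 0`. -/
def azumaBound (p r K : ℝ) (b : ℝ≥0∞) : ℝ≥0∞ :=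
  2 * EReal.exp (-((ENNReal.ofReal r ^ p / (2 * ENNReal.ofReal K * b) : ℝ≥0∞) : EReal))

end

/-! The argument builds an exponential supermartingale from the potential h(x) = √(1 + ‖x‖²). If J
norms x, then J is a subgradient of the norm, and `p`-smoothness gives ‖x + y‖ ≤ ‖x‖ + J y +
2s‖y‖^p‖x‖^(1-p). The remainder is singular at x = 0, but the derivative of √(1 + t²) vanishes there
and cancels the singularity. Hence h has a gradient field L with h(x + y) ≤ h(x) + L x y + (2s +
2)‖y‖^p globally (`exists_gradient_bounds`). These bounds force L to be norm continuous, so L ∘ g n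
is strongly measurable.

With e^t ≤ t + e^(t²), exp(l h(g n)) divided by its compensator is bounded by the previous value
plus a predictable functional applied to a martingale difference, which integrates to zero
(`supermartingale_azumaExp`). Doob's inequality then bounds the tail. After scaling to s ∑ v^p ≤ 1,
the bound s ≥ 1/4 turns all constants into numbers; optimizing l gives Gaussian decay for large
radii, which dominates exp(-c u^p) because p ≤ 2. For small radii the factor 2 makes the claim
trivial. -/

/-! ### Geometry of smooth norms. -/

section Geometry

variable {X : Type u} [NormedAddCommGroup X] [NormedSpace ℝ X] {p s : ℝ}

theorem le_smoothnessModulus {τ : ℝ} (hτ : 0 ≤ τ) {x y : X} (hx : ‖x‖ = 1) (hy : ‖y‖ = 1) :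
    (‖x + τ • y‖ + ‖x - τ • y‖) / 2 - 1 ≤ smoothnessModulus X τ := by
  refine le_csSup ⟨τ, ?_⟩ ⟨x, y, hx, hy, rfl⟩
  rintro a ⟨x, y, hx, hy, rfl⟩
  have hτy : ‖τ • y‖ = τ := by rw [norm_smul, hy, mul_one, Real.norm_of_nonneg hτ]
  have h₁ := norm_add_le x (τ • y)
  have h₂ := norm_sub_le x (τ • y)
  linarith

/-- Taking y = x and τ = 2 gives ρ(2) ≥ 1, while 2^p ≤ 4. This bound later absorbs additive
constants into multiples of s. -/
theorem quarter_le_of_mem_smoothnessBounds [Nontrivial X] (hp : p ≤ 2)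
    (hs : s ∈ smoothnessBounds X p) : 1 / 4 ≤ s := by
  obtain ⟨x, hx⟩ := exists_norm_eq X zero_le_one
  have h := (le_smoothnessModulus zero_le_two hx hx).trans (hs.2 2 two_pos)
  have e₁ : x + (2 : ℝ) • x = (3 : ℝ) • x := by module
  have e₂ : x - (2 : ℝ) • x = (-1 : ℝ) • x := by module
  rw [e₁, e₂, norm_smul, norm_smul, hx] at h
  have h2 : (2 : ℝ) ^ p ≤ 4 := by
    calc (2 : ℝ) ^ p ≤ 2 ^ (2 : ℝ) := Real.rpow_le_rpow_of_exponent_le one_le_two hp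
      _ = 4 := by norm_num
  norm_num at h
  nlinarith [hs.1]

theorem smoothnessConstant_mem [Nontrivial X] (hp : p ≤ 2) (h : IsUniformlySmooth X p) :
    smoothnessConstant X p ∈ smoothnessBounds X p := by
  have h4 : 1 / 4 ≤ smoothnessConstant X p :=
    le_csInf h fun s hs => quarter_le_of_mem_smoothnessBounds hp hs
  refine ⟨by linarith, fun τ hτ => ?_⟩
  have hτp : 0 < τ ^ p := Real.rpow_pos_of_pos hτ p
  rw [← div_le_iff₀ hτp]
  exact le_csInf h fun s hs => (div_le_iff₀ hτp).2 (hs.2 τ hτ)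

theorem norm_add_add_norm_sub_le (hs : s ∈ smoothnessBounds X p) {x : X} (hx : x ≠ 0) (y : X) :
    ‖x + y‖ + ‖x - y‖ ≤ 2 * ‖x‖ + 2 * s * ‖y‖ ^ p * ‖x‖ ^ (1 - p) := by
  have hx0 : 0 < ‖x‖ := norm_pos_iff.2 hx
  rcases eq_or_ne y 0 with rfl | hy
  · have : 0 ≤ 2 * s * ‖(0 : X)‖ ^ p * ‖x‖ ^ (1 - p) := by have := hs.1; positivity
    simp only [add_zero, sub_zero]
    linarith
  have hy0 : 0 < ‖y‖ := norm_pos_iff.2 hy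
  have hτ : 0 < ‖y‖ / ‖x‖ := by positivity
  have h := (le_smoothnessModulus hτ.le (norm_smul_inv_norm (𝕜 := ℝ) hx)
    (norm_smul_inv_norm (𝕜 := ℝ) hy)).trans (hs.2 _ hτ)
  simp only [RCLike.ofReal_real_eq_id, id_eq] at h
  have e : (‖y‖ / ‖x‖) • ‖y‖⁻¹ • y = ‖x‖⁻¹ • y := by
    rw [smul_smul]; congr 1; field_simp
  rw [e, ← smul_add, ← smul_sub, norm_smul, norm_smul, norm_inv, norm_norm,
    Real.div_rpow hy0.le hx0.le] at h
  have hmul := mul_le_mul_of_nonneg_left h (by positivity : 0 ≤ 2 * ‖x‖)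
  rw [Real.rpow_sub hx0, Real.rpow_one]
  have hxp : 0 < ‖x‖ ^ p := Real.rpow_pos_of_pos hx0 p
  have e₁ : 2 * ‖x‖ * ((‖x‖⁻¹ * ‖x + y‖ + ‖x‖⁻¹ * ‖x - y‖) / 2 - 1)
      = ‖x + y‖ + ‖x - y‖ - 2 * ‖x‖ := by field_simp
  have e₂ : 2 * ‖x‖ * (s * (‖y‖ ^ p / ‖x‖ ^ p)) = 2 * s * ‖y‖ ^ p * (‖x‖ / ‖x‖ ^ p) := by
    field_simp
  rw [e₁, e₂] at hmul
  linarith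

/-- The norming functional gives ‖x - y‖ ≥ ‖x‖ - J y, which turns the symmetric estimate into a
one-sided first-order expansion. -/
theorem norm_add_le_of_norming (hs : s ∈ smoothnessBounds X p) {x : X} (hx : x ≠ 0)
    {J : StrongDual ℝ X} (hJ : ‖J‖ ≤ 1) (hJx : J x = ‖x‖) (y : X) :
    ‖x + y‖ ≤ ‖x‖ + J y + 2 * s * ‖y‖ ^ p * ‖x‖ ^ (1 - p) := by
  have h := norm_add_add_norm_sub_le hs hx y
  have h' : J (x - y) ≤ ‖x - y‖ := by
    calc J (x - y) ≤ ‖J (x - y)‖ := Real.le_norm_self _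
      _ ≤ 1 * ‖x - y‖ := J.le_of_opNorm_le hJ _
      _ = ‖x - y‖ := one_mul _
  rw [map_sub, hJx] at h'
  linarith

end Geometry

/-! ### Scalar inequalities. -/

section Scalar

theorem sqrt_one_add_sq_le (t u : ℝ) : √(1 + u ^ 2) ≤ √(1 + t ^ 2) + |u - t| := by
  have ht : |t| ≤ √(1 + t ^ 2) := Real.abs_le_sqrt (by linarith)
  refine Real.sqrt_le_iff.2 ⟨by positivity, ?_⟩
  have hsq := Real.sq_sqrt (by positivity : 0 ≤ 1 + t ^ 2)
  have h : t * (u - t) ≤ √(1 + t ^ 2) * |u - t| := by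
    calc t * (u - t) ≤ |t * (u - t)| := le_abs_self _
      _ = |t| * |u - t| := abs_mul _ _
      _ ≤ _ := by gcongr
  nlinarith [sq_abs (u - t)]

/-- For |u - t| ≤ 1 the quadratic Taylor remainder is below the p-th power; beyond 1, the Lipschitz
bound suffices and costs 2|u - t|. -/
theorem sqrt_one_add_sq_le_add_rpow {p : ℝ} (hp₁ : 1 ≤ p) (hp₂ : p ≤ 2) {t : ℝ} (ht : 0 ≤ t)
    (u : ℝ) :
    √(1 + u ^ 2) ≤ √(1 + t ^ 2) + t / √(1 + t ^ 2) * (u - t) + 2 * |u - t| ^ p := by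
  have h1 : 1 ≤ √(1 + t ^ 2) := Real.one_le_sqrt.2 (by nlinarith)
  have hsq := Real.sq_sqrt (by positivity : 0 ≤ 1 + t ^ 2)
  have hsu := Real.sq_sqrt (by positivity : 0 ≤ 1 + u ^ 2)
  have hu0 := Real.sqrt_nonneg (1 + u ^ 2)
  set a := √(1 + t ^ 2)
  set b := √(1 + u ^ 2)
  have hta : t ≤ a := Real.le_sqrt_of_sq_le (by linarith)
  rcases le_total |u - t| 1 with h | h
  · have hle : |u - t| ^ 2 ≤ |u - t| ^ p := by
      rcases (abs_nonneg (u - t)).eq_or_lt' with h0 | h0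
      · rw [h0, Real.zero_rpow (by linarith)]; norm_num
      · rw [← Real.rpow_natCast]
        exact Real.rpow_le_rpow_of_exponent_ge h0 h (by exact_mod_cast hp₂)
    have hq : b ≤ a + t / a * (u - t) + (u - t) ^ 2 := by
      have e : t / a * (u - t) = t * (u - t) / a := by ring
      have : b - a - (u - t) ^ 2 ≤ t * (u - t) / a := by
        rw [le_div_iff₀ (by linarith)]
        nlinarith [sq_nonneg (b - a), sq_nonneg (u - t),
          mul_nonneg (sq_nonneg (u - t)) (sub_nonneg.2 h1)]
      linarith
    rw [sq_abs] at hle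
    nlinarith [sq_nonneg (u - t)]
  · have hle : |u - t| ≤ |u - t| ^ p := Real.self_le_rpow_of_one_le h hp₁
    have hb : b ≤ a + |u - t| := sqrt_one_add_sq_le t u
    have : -|u - t| ≤ t / a * (u - t) := by
      have h₁ : |t / a * (u - t)| ≤ 1 * |u - t| := by
        rw [abs_mul, abs_of_nonneg (by positivity : 0 ≤ t / a)]
        gcongr
        exact (div_le_one (by linarith)).2 hta
      have := neg_abs_le (t / a * (u - t))
      linarith
    linarith

theorem sqrt_one_add_sq_ge (t u : ℝ) :
    √(1 + t ^ 2) + t / √(1 + t ^ 2) * (u - t) ≤ √(1 + u ^ 2) := by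
  have h1 : 1 ≤ √(1 + t ^ 2) := Real.one_le_sqrt.2 (by nlinarith)
  have hsq := Real.sq_sqrt (by positivity : 0 ≤ 1 + t ^ 2)
  have e : √(1 + t ^ 2) + t / √(1 + t ^ 2) * (u - t) = (1 + t * u) / √(1 + t ^ 2) := by
    field_simp
    rw [hsq]; ring
  rw [e, div_le_iff₀ (by linarith), ← Real.sqrt_mul (by positivity)]
  exact Real.le_sqrt_of_sq_le (by nlinarith [sq_nonneg (u - t)])

/-- This is the cancellation of the singularity ‖x‖^(1-p) by the derivative of √(1 + t²). -/
theorem div_sqrt_mul_rpow_le_one {p : ℝ} (hp₁ : 1 ≤ p) (hp₂ : p ≤ 2) {t : ℝ} (ht : 0 < t) :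
    t / √(1 + t ^ 2) * t ^ (1 - p) ≤ 1 := by
  have h1 : 1 ≤ √(1 + t ^ 2) := Real.one_le_sqrt.2 (by nlinarith)
  have hta : t ≤ √(1 + t ^ 2) := Real.le_sqrt_of_sq_le (by linarith)
  rcases le_total t 1 with h | h
  · have h2 : t * t ^ (1 - p) ≤ 1 := by
      nth_rewrite 1 [← Real.rpow_one t]
      rw [← Real.rpow_add ht]
      exact Real.rpow_le_one ht.le h (by linarith)
    rw [div_mul_eq_mul_div]
    exact (div_le_one (by linarith)).2 (h2.trans h1)
  · have h2 : t ^ (1 - p) ≤ 1 := Real.rpow_le_one_of_one_le_of_nonpos h (by linarith)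
    exact mul_le_one₀ ((div_le_one (by linarith)).2 hta) (by positivity) h2

theorem exp_le_add_exp_sq (t : ℝ) : Real.exp t ≤ t + Real.exp (t ^ 2) := by
  have h2 := Real.add_one_le_exp (t ^ 2)
  rcases le_total |t| 1 with h | h
  · have := (abs_le.1 (Real.abs_exp_sub_one_sub_id_le h)).2
    linarith
  rcases le_total 0 t with h0 | h0
  · rw [abs_of_nonneg h0] at h
    have : Real.exp t ≤ Real.exp (t ^ 2) := Real.exp_le_exp.2 (by nlinarith)
    linarith
  · rw [abs_of_nonpos h0] at h
    have : Real.exp t ≤ 1 := Real.exp_le_one_iff.2 h0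
    nlinarith

end Scalar

/-! ### The potential √(1 + ‖x‖²) and its gradient. -/

section Potential

variable {X : Type u} [NormedAddCommGroup X] [NormedSpace ℝ X] {p s : ℝ}

theorem exists_gradient_bounds (hp₁ : 1 ≤ p) (hp₂ : p ≤ 2) (hs : s ∈ smoothnessBounds X p)
    (x : X) : ∃ L : StrongDual ℝ X, ‖L‖ ≤ 1 ∧
      (∀ y, √(1 + ‖x‖ ^ 2) + L y ≤ √(1 + ‖x + y‖ ^ 2)) ∧
      ∀ y, √(1 + ‖x + y‖ ^ 2) ≤ √(1 + ‖x‖ ^ 2) + L y + (2 * s + 2) * ‖y‖ ^ p := by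
  obtain ⟨J, hJ, hJx⟩ := exists_dual_vector'' ℝ x
  simp only [RCLike.ofReal_real_eq_id, id_eq] at hJx
  have hcoef : ‖x‖ / √(1 + ‖x‖ ^ 2) ≤ 1 :=
    (div_le_one (by positivity)).2 (Real.le_sqrt_of_sq_le (by linarith))
  have hc0 : 0 ≤ ‖x‖ / √(1 + ‖x‖ ^ 2) := by positivity
  refine ⟨(‖x‖ / √(1 + ‖x‖ ^ 2)) • J, ?_, fun y => ?_, fun y => ?_⟩
  · rw [norm_smul, Real.norm_of_nonneg hc0]
    exact mul_le_one₀ hcoef (norm_nonneg _) hJ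
  · have h : J y ≤ ‖x + y‖ - ‖x‖ := by
      have h' : J (x + y) ≤ ‖x + y‖ := by
        calc J (x + y) ≤ ‖J (x + y)‖ := Real.le_norm_self _
          _ ≤ 1 * ‖x + y‖ := J.le_of_opNorm_le hJ _
          _ = ‖x + y‖ := one_mul _
      rw [map_add, hJx] at h'
      linarith
    have h₁ := mul_le_mul_of_nonneg_left h hc0
    have h₂ := sqrt_one_add_sq_ge ‖x‖ ‖x + y‖
    simp only [smul_apply, smul_eq_mul]
    linarith
  · have h₂ := sqrt_one_add_sq_le_add_rpow hp₁ hp₂ (norm_nonneg x) ‖x + y‖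
    have h₃ : |‖x + y‖ - ‖x‖| ^ p ≤ ‖y‖ ^ p := by
      refine Real.rpow_le_rpow (abs_nonneg _) ?_ (by linarith)
      simpa using abs_norm_sub_norm_le (x + y) x
    simp only [smul_apply, smul_eq_mul]
    rcases eq_or_ne x 0 with rfl | hx
    · simp only [norm_zero, zero_div, zero_mul] at h₂ h₃ ⊢
      have : 0 ≤ 2 * s * ‖y‖ ^ p := by have := hs.1; positivity
      linarith
    · have h₁ := mul_le_mul_of_nonneg_left (norm_add_le_of_norming hs hx hJ hJx y) hc0
      have h₄ := mul_le_mul_of_nonneg_left (div_sqrt_mul_rpow_le_one hp₁ hp₂ (norm_pos_iff.2 hx))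
        (by have := hs.1; positivity : 0 ≤ 2 * s * ‖y‖ ^ p)
      nlinarith

/-- A choice of gradients of a function with two-sided `p`-power first-order bounds is
continuous. -/
theorem continuous_of_gradient_bounds (hp : 1 < p) {C : ℝ} (hC : 0 ≤ C) {h : X → ℝ}
    {L : X → StrongDual ℝ X} (hL : ∀ x, ‖L x‖ ≤ 1) (hlow : ∀ x y, h x + L x y ≤ h (x + y))
    (hup : ∀ x y, h (x + y) ≤ h x + L x y + C * ‖y‖ ^ p) : Continuous L := by
  have key : ∀ x x' : X, ∀ t : ℝ, 0 < t →
      ‖L x' - L x‖ ≤ (2 * ‖x' - x‖) / t + C * t ^ (p - 1) := by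
    intro x x' t ht
    have hbd : ∀ y : X, ‖y‖ = t → (L x' - L x) y ≤ 2 * ‖x' - x‖ + C * t ^ p := by
      intro y hy
      -- The lower bound at x' and the upper bound at x are compared at the same point x + y.
      have h₁ := hlow x' (x + y - x')
      have h₂ := hup x y
      have h₃ := hlow x (x' - x)
      have e₁ : x' + (x + y - x') = x + y := by abel
      have e₂ : x + (x' - x) = x' := by abel
      have e₃ : L x' (x + y - x') = L x' y - L x' (x' - x) := by simp only [map_sub, map_add]; ring
      rw [e₁, e₃] at h₁
      rw [e₂] at h₃
      rw [hy] at h₂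
      have h₄ : |L x' (x' - x)| ≤ 1 * ‖x' - x‖ := (L x').le_of_opNorm_le (hL _) _
      have h₅ : |L x (x' - x)| ≤ 1 * ‖x' - x‖ := (L x).le_of_opNorm_le (hL _) _
      have h₆ := (abs_le.1 h₄).2
      have h₇ := (abs_le.1 h₅).1
      rw [sub_apply]
      linarith
    have htp : t ^ (p - 1) = t ^ p / t := by rw [Real.rpow_sub ht, Real.rpow_one]
    refine ContinuousLinearMap.opNorm_le_bound _ (by positivity) fun y => ?_
    rcases eq_or_ne y 0 with rfl | hy
    · simp
    have hy0 : 0 < ‖y‖ := norm_pos_iff.2 hy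
    have hn : ‖(t / ‖y‖) • y‖ = t := by
      rw [norm_smul, Real.norm_of_nonneg (by positivity)]; field_simp
    have h₁ := hbd _ hn
    have h₂ := hbd (-((t / ‖y‖) • y)) (by rw [norm_neg, hn])
    rw [map_neg] at h₂
    rw [map_smul, smul_eq_mul] at h₁ h₂
    have habs : |t / ‖y‖ * (L x' - L x) y| ≤ 2 * ‖x' - x‖ + C * t ^ p :=
      abs_le.2 ⟨by linarith, h₁⟩
    rw [abs_mul, abs_of_nonneg (by positivity : 0 ≤ t / ‖y‖)] at habs
    rw [htp, Real.norm_eq_abs]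
    have := mul_le_mul_of_nonneg_left habs (by positivity : 0 ≤ ‖y‖ / t)
    calc |(L x' - L x) y| = ‖y‖ / t * (t / ‖y‖ * |(L x' - L x) y|) := by field_simp
      _ ≤ ‖y‖ / t * (2 * ‖x' - x‖ + C * t ^ p) := this
      _ = _ := by field_simp
  refine continuous_iff_continuousAt.2 fun x => Metric.continuousAt_iff.2 fun ε hε => ?_
  -- Since p > 1, the scale t can be fixed first, independently of x'; then x' is taken close to x.
  obtain ⟨t, ht, htε⟩ : ∃ t : ℝ, 0 < t ∧ C * t ^ (p - 1) < ε / 2 := by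
    have hcont : Filter.Tendsto (fun t : ℝ => C * t ^ (p - 1)) (nhdsWithin 0 (Set.Ioi 0))
        (nhds 0) := by
      have : ContinuousAt (fun t : ℝ => C * t ^ (p - 1)) 0 :=
        (Real.continuousAt_rpow_const 0 (p - 1) (Or.inr (by linarith))).const_mul C
      have h0 := this.tendsto
      rw [Real.zero_rpow (by linarith), mul_zero] at h0
      exact h0.mono_left nhdsWithin_le_nhds
    have := (hcont.eventually (gt_mem_nhds (half_pos hε))).and self_mem_nhdsWithin
    obtain ⟨t, ht⟩ := this.exists
    exact ⟨t, ht.2, ht.1⟩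
  refine ⟨ε * t / 4, by positivity, fun {x'} hx' => ?_⟩
  rw [dist_eq_norm] at hx' ⊢
  have : 2 * ‖x' - x‖ / t < ε / 2 := by
    rw [div_lt_iff₀ ht]; linarith
  linarith [key x x' t ht]

end Potential

/-! ### Doob's inequality and martingale differences. -/

section Supermartingale

variable {Ω : Type v} {m : MeasurableSpace Ω} {μ : Measure Ω} [IsFiniteMeasure μ]
  {ℱ : Filtration ℕ m}

/-- Doob's maximal inequality for nonnegative supermartingales. -/
theorem MeasureTheory.Supermartingale.mul_measureReal_exists_le_le {M : ℕ → Ω → ℝ}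
    (hM : Supermartingale M ℱ μ) (h0 : ∀ n ω, 0 ≤ M n ω) (ε : ℝ) (n : ℕ) :
    ε * μ.real {ω | ∃ k ≤ n, ε ≤ M k ω} ≤ ∫ ω, M 0 ω ∂μ := by
  have hmeas : ∀ n, MeasurableSet[ℱ n] {ω | ε ≤ M n ω} := fun n =>
    measurableSet_le measurable_const (hM.stronglyAdapted n).measurable
  have hA : ∀ n, MeasurableSet[ℱ n] {ω | ∃ k ≤ n, ε ≤ M k ω} := by
    intro n
    have e : {ω | ∃ k ≤ n, ε ≤ M k ω} = ⋃ k ∈ Set.Iic n, {ω | ε ≤ M k ω} := by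
      ext ω; simp
    rw [e]
    exact MeasurableSet.biUnion (Set.to_countable _) fun k hk => ℱ.mono hk _ (hmeas k)
  have hconst : ∀ n (S : Set Ω), MeasurableSet S → S ⊆ {ω | ε ≤ M n ω} →
      ε * μ.real S ≤ ∫ ω in S, M n ω ∂μ := fun n S hS hsub => by
    have := setIntegral_mono_on (μ := μ) (integrable_const ε).integrableOn
      (hM.integrable n).integrableOn hS fun ω hω => hsub hω
    rwa [setIntegral_const, smul_eq_mul, mul_comm] at this
  -- Keeping the mass of M n off the exceedance set makes the claim inductive: at each step it pays
  -- for the newly exceeding paths.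
  suffices H : ε * μ.real {ω | ∃ k ≤ n, ε ≤ M k ω}
      + ∫ ω in {ω | ∃ k ≤ n, ε ≤ M k ω}ᶜ, M n ω ∂μ ≤ ∫ ω, M 0 ω ∂μ by
    have : 0 ≤ ∫ ω in {ω | ∃ k ≤ n, ε ≤ M k ω}ᶜ, M n ω ∂μ :=
      integral_nonneg fun ω => h0 n ω
    linarith
  induction n with
  | zero =>
    have hA0 := ℱ.le 0 _ (hA 0)
    rw [← integral_add_compl hA0 (hM.integrable 0)]
    gcongr
    exact hconst 0 _ hA0 fun ω ⟨k, hk, h⟩ => by rwa [Nat.le_zero.1 hk] at h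
  | succ n ih =>
    set A : Set Ω := {ω | ∃ k ≤ n, ε ≤ M k ω} with hAdef
    set A' : Set Ω := {ω | ∃ k ≤ n + 1, ε ≤ M k ω} with hAdef'
    have hAm := ℱ.le n _ (hA n)
    have hAm' := ℱ.le (n + 1) _ (hA (n + 1))
    have hsub : A ⊆ A' := fun ω ⟨k, hk, h⟩ => ⟨k, hk.trans n.le_succ, h⟩
    have hdiff : A' \ A ⊆ {ω | ε ≤ M (n + 1) ω} := by
      rintro ω ⟨⟨k, hk, h⟩, hω⟩
      rcases Nat.le_succ_iff.1 hk with hk' | rfl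
      · exact absurd ⟨k, hk', h⟩ hω
      · exact h
    have h₁ := hM.setIntegral_le n.le_succ (hA n).compl
    have h₂ := hconst (n + 1) _ (hAm'.diff hAm) hdiff
    have h₃ : ∫ ω in Aᶜ, M (n + 1) ω ∂μ
        = ∫ ω in A' \ A, M (n + 1) ω ∂μ + ∫ ω in A'ᶜ, M (n + 1) ω ∂μ := by
      rw [← setIntegral_union _ hAm'.compl (hM.integrable _).integrableOn
        (hM.integrable _).integrableOn]
      · congr 2
        ext ω
        have := @hsub ω
        simp only [Set.mem_compl_iff, Set.mem_union, Set.mem_sdiff]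
        tauto
      · exact Set.disjoint_left.2 fun ω hω hω' => hω' hω.1
    have h₄ : μ.real A' = μ.real A + μ.real (A' \ A) := by
      rw [measureReal_sdiff hsub hAm]; ring
    rw [h₄]
    change ∫ ω in Aᶜ, M (n + 1) ω ∂μ ≤ ∫ ω in Aᶜ, M n ω ∂μ at h₁
    linarith

variable {X : Type u} [NormedAddCommGroup X] [NormedSpace ℝ X] [CompleteSpace X]

theorem MeasureTheory.Martingale.integral_clm_apply_sub_eq_zero {f : ℕ → Ω → X}
    (hf : Martingale f ℱ μ) {n : ℕ} {Y : Ω → StrongDual ℝ X} (hY : StronglyMeasurable[ℱ n] Y)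
    (hint : Integrable (fun ω => Y ω (f (n + 1) ω - f n ω)) μ) :
    ∫ ω, Y ω (f (n + 1) ω - f n ω) ∂μ = 0 := by
  have hd : Integrable (fun ω => f (n + 1) ω - f n ω) μ :=
    (hf.integrable (n + 1)).sub (hf.integrable n)
  have hce : μ[fun ω => f (n + 1) ω - f n ω | ℱ n] =ᵐ[μ] 0 := by
    have h₁ := condExp_sub (hf.integrable (n + 1)) (hf.integrable n) (ℱ n)
    have h₂ := hf.2 n (n + 1) n.le_succ
    have h₃ := hf.2 n n le_rfl
    filter_upwards [h₁, h₂, h₃] with ω e₁ e₂ e₃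
    change (μ[f (n + 1) - f n | ℱ n]) ω = 0
    rw [e₁, Pi.sub_apply, e₂, e₃, sub_self]
  have h := condExp_bilin_of_stronglyMeasurable_left (ContinuousLinearMap.id ℝ (StrongDual ℝ X))
    hY hint hd
  simp only [ContinuousLinearMap.id_apply] at h
  rw [← integral_condExp (ℱ.le n), integral_congr_ae h]
  refine integral_eq_zero_of_ae ?_
  filter_upwards [hce] with ω hω
  simp [hω]

end Supermartingale

/-! ### The exponential supermartingale. -/

section AzumaExp

variable {Ω : Type v} {X : Type u} [NormedAddCommGroup X]

/-- The process `exp (l √(1 + ‖g n‖ ^ 2) - ∑_{j ≤ n} (l C v_j ^ p + l ^ 2 v_j ^ 2))`. -/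
noncomputable def azumaExp (p C l : ℝ) (g : ℕ → Ω → X) (v : ℕ → Ω → ℝ) (n : ℕ) (ω : Ω) : ℝ :=
  Real.exp (l * √(1 + ‖g n ω‖ ^ 2)
    - ∑ j ∈ Finset.range n, (l * (C * v (j + 1) ω ^ p) + l ^ 2 * v (j + 1) ω ^ 2))

theorem azumaExp_pos (p C l : ℝ) (g : ℕ → Ω → X) (v : ℕ → Ω → ℝ) (n : ℕ) (ω : Ω) :
    0 < azumaExp p C l g v n ω :=
  Real.exp_pos _

variable {m : MeasurableSpace Ω} {μ : Measure Ω} {ℱ : Filtration ℕ m}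

theorem stronglyMeasurable_azumaExp {p C l : ℝ} {g : ℕ → Ω → X} {v : ℕ → Ω → ℝ}
    (hg : StronglyAdapted ℱ g) (hv : IsPredictableSeq ℱ v) (n : ℕ) :
    StronglyMeasurable[ℱ n] (azumaExp p C l g v n) := by
  have h₁ : StronglyMeasurable[ℱ n] fun ω => √(1 + ‖g n ω‖ ^ 2) :=
    (by fun_prop : Continuous fun x : X => √(1 + ‖x‖ ^ 2)).comp_stronglyMeasurable (hg n)
  have h₂ : ∀ j ∈ Finset.range n, Measurable[ℱ n] fun ω =>
      l * (C * v (j + 1) ω ^ p) + l ^ 2 * v (j + 1) ω ^ 2 := fun j hj => by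
    have hj' : Measurable[ℱ n] (v (j + 1)) :=
      (hv j).mono (ℱ.mono (Finset.mem_range.1 hj).le) le_rfl
    exact ((hj'.pow_const p).const_mul C |>.const_mul l).add ((hj'.pow_const 2).const_mul _)
  exact (Real.measurable_exp.comp
    ((h₁.measurable.const_mul l).sub (Finset.measurable_fun_sum _ h₂))).stronglyMeasurable

theorem azumaExp_le {p C l B : ℝ} (hC : 0 ≤ C) (hl : 0 ≤ l) {g : ℕ → Ω → X} {v : ℕ → Ω → ℝ}
    {ω : Ω} (h0 : g 0 ω = 0) (hd : ∀ j, ‖g (j + 1) ω - g j ω‖ ≤ v (j + 1) ω)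
    (hB : ∀ j, v (j + 1) ω ≤ B) (n : ℕ) :
    azumaExp p C l g v n ω ≤ Real.exp (l * (1 + n * B)) := by
  have hg : ‖g n ω‖ ≤ n * B := by
    induction n with
    | zero => simp [h0]
    | succ n ih =>
      have := norm_le_insert' (g (n + 1) ω) (g n ω)
      push_cast
      linarith [hd n, hB n]
  refine Real.exp_le_exp.2 ?_
  have hs : √(1 + ‖g n ω‖ ^ 2) ≤ 1 + ‖g n ω‖ :=
    Real.sqrt_le_iff.2 ⟨by positivity, by nlinarith [norm_nonneg (g n ω)]⟩
  have h₁ : l * √(1 + ‖g n ω‖ ^ 2) ≤ l * (1 + n * B) :=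
    mul_le_mul_of_nonneg_left (by linarith) hl
  have h₂ : 0 ≤ ∑ j ∈ Finset.range n, (l * (C * v (j + 1) ω ^ p) + l ^ 2 * v (j + 1) ω ^ 2) :=
    Finset.sum_nonneg fun j _ => by
      have := (norm_nonneg _).trans (hd j)
      positivity
  linarith

variable [NormedSpace ℝ X]

/-- The compensator l C v^p absorbs the smoothness remainder and l² v² absorbs the term e^((lz)²)
from `exp_le_add_exp_sq`; only a term linear in the increment survives. -/
theorem azumaExp_succ_le {p C l : ℝ} (hp : 1 ≤ p) (hC : 0 ≤ C) (hl : 0 ≤ l)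
    {L : X → StrongDual ℝ X} (hL : ∀ x, ‖L x‖ ≤ 1)
    (hup : ∀ x y, √(1 + ‖x + y‖ ^ 2) ≤ √(1 + ‖x‖ ^ 2) + L x y + C * ‖y‖ ^ p)
    {g : ℕ → Ω → X} {v : ℕ → Ω → ℝ} {n : ℕ} {ω : Ω}
    (hd : ‖g (n + 1) ω - g n ω‖ ≤ v (n + 1) ω) :
    azumaExp p C l g v (n + 1) ω ≤ azumaExp p C l g v n ω
      + (l * azumaExp p C l g v n ω * Real.exp (-(l ^ 2 * v (n + 1) ω ^ 2)))
        * L (g n ω) (g (n + 1) ω - g n ω) := by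
  have h := hup (g n ω) (g (n + 1) ω - g n ω)
  rw [add_sub_cancel] at h
  have habs : |L (g n ω) (g (n + 1) ω - g n ω)| ≤ v (n + 1) ω := by
    have := (L (g n ω)).le_of_opNorm_le (hL _) (g (n + 1) ω - g n ω)
    rw [one_mul, Real.norm_eq_abs] at this
    exact this.trans hd
  have hpow : ‖g (n + 1) ω - g n ω‖ ^ p ≤ v (n + 1) ω ^ p :=
    Real.rpow_le_rpow (norm_nonneg _) hd (by linarith)
  set z := L (g n ω) (g (n + 1) ω - g n ω)
  set w := v (n + 1) ω
  set M := azumaExp p C l g v n ω with hM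
  have hM0 : 0 < M := Real.exp_pos _
  have h₁ : azumaExp p C l g v (n + 1) ω
      ≤ M * (Real.exp (l * z) * Real.exp (-(l ^ 2 * w ^ 2))) := by
    rw [hM, azumaExp, azumaExp, ← Real.exp_add, ← Real.exp_add, Finset.sum_range_succ]
    refine Real.exp_le_exp.2 ?_
    have h₂ : √(1 + ‖g (n + 1) ω‖ ^ 2) ≤ √(1 + ‖g n ω‖ ^ 2) + z + C * w ^ p :=
      h.trans (by gcongr)
    have := mul_le_mul_of_nonneg_left h₂ hl
    linarith
  have hz2 : z ^ 2 ≤ w ^ 2 := by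
    rw [← sq_abs z]; gcongr
  have h₂ : Real.exp (l * z) * Real.exp (-(l ^ 2 * w ^ 2))
      ≤ 1 + l * z * Real.exp (-(l ^ 2 * w ^ 2)) := by
    have h₃ := mul_le_mul_of_nonneg_right (exp_le_add_exp_sq (l * z))
      (Real.exp_pos (-(l ^ 2 * w ^ 2))).le
    have h₄ : Real.exp ((l * z) ^ 2) * Real.exp (-(l ^ 2 * w ^ 2)) ≤ 1 := by
      rw [← Real.exp_add]
      refine Real.exp_le_one_iff.2 ?_
      nlinarith [sq_nonneg l]
    linarith
  have h₃ := mul_le_mul_of_nonneg_left h₂ hM0.le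
  linarith

theorem supermartingale_azumaExp [IsFiniteMeasure μ] [CompleteSpace X] {p C l B : ℝ}
    (hp : 1 ≤ p) (hC : 0 ≤ C) (hl : 0 ≤ l)
    {L : X → StrongDual ℝ X} (hLc : Continuous L) (hL : ∀ x, ‖L x‖ ≤ 1)
    (hup : ∀ x y, √(1 + ‖x + y‖ ^ 2) ≤ √(1 + ‖x‖ ^ 2) + L x y + C * ‖y‖ ^ p)
    {g : ℕ → Ω → X} {v : ℕ → Ω → ℝ} (hg : Martingale g ℱ μ) (hv : IsPredictableSeq ℱ v)
    (h0 : ∀ ω, g 0 ω = 0) (hd : ∀ᵐ ω ∂μ, ∀ j, ‖g (j + 1) ω - g j ω‖ ≤ v (j + 1) ω)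
    (hB : ∀ᵐ ω ∂μ, ∀ j, v (j + 1) ω ≤ B) :
    Supermartingale (azumaExp p C l g v) ℱ μ := by
  have hadp : StronglyAdapted ℱ (azumaExp p C l g v) :=
    stronglyMeasurable_azumaExp hg.1 hv
  have hbd : ∀ n, ∀ᵐ ω ∂μ, ‖azumaExp p C l g v n ω‖ ≤ Real.exp (l * (1 + n * B)) := fun n => by
    filter_upwards [hd, hB] with ω h₁ h₂
    rw [Real.norm_of_nonneg (azumaExp_pos ..).le]
    exact azumaExp_le hC hl (h0 ω) h₁ h₂ n
  have hint : ∀ n, Integrable (azumaExp p C l g v n) μ := fun n =>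
    Integrable.of_bound ((hadp n).mono (ℱ.le n)).aestronglyMeasurable _ (hbd n)
  refine supermartingale_of_setIntegral_succ_le hadp hint fun n A hA => ?_
  set a : Ω → ℝ := fun ω =>
    l * azumaExp p C l g v n ω * Real.exp (-(l ^ 2 * v (n + 1) ω ^ 2)) with ha
  have ham : StronglyMeasurable[ℱ n] a :=
    ((hadp n).measurable.const_mul l |>.mul (Real.measurable_exp.comp
      (((hv n).pow_const 2).const_mul (l ^ 2)).neg)).stronglyMeasurable
  -- The linear term restricted to A is an ℱ n-measurable functional applied to the martingale
  -- difference, so its integral vanishes.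
  set Y : Ω → StrongDual ℝ X := A.indicator fun ω => a ω • L (g n ω) with hY
  have hYm : StronglyMeasurable[ℱ n] Y :=
    (ham.smul (hLc.comp_stronglyMeasurable (hg.1 n))).indicator hA
  have hdint : Integrable (fun ω => g (n + 1) ω - g n ω) μ :=
    (hg.integrable (n + 1)).sub (hg.integrable n)
  have hYd : Integrable (fun ω => Y ω (g (n + 1) ω - g n ω)) μ := by
    refine Integrable.mono' (hdint.norm.const_mul (l * Real.exp (l * (1 + n * B)))) ?_ ?_
    · exact (ContinuousLinearMap.id ℝ (StrongDual ℝ X)).aestronglyMeasurable_comp₂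
        (hYm.mono (ℱ.le n)).aestronglyMeasurable hdint.aestronglyMeasurable
    · filter_upwards [hbd n] with ω hω
      refine (Y ω).le_of_opNorm_le ?_ _
      rw [hY]
      refine (norm_indicator_le_norm_self _ _).trans ?_
      rw [norm_smul]
      refine (mul_le_of_le_one_right (norm_nonneg _) (hL _)).trans ?_
      rw [ha]
      rw [norm_mul, norm_mul, Real.norm_of_nonneg hl, Real.norm_of_nonneg (Real.exp_pos _).le]
      refine (mul_le_of_le_one_right (by positivity) (Real.exp_le_one_iff.2 ?_)).trans
        (mul_le_mul_of_nonneg_left hω hl)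
      exact neg_nonpos.2 (by positivity)
  have hYA : ∫ ω in A, a ω * L (g n ω) (g (n + 1) ω - g n ω) ∂μ = 0 := by
    rw [← hg.integral_clm_apply_sub_eq_zero hYm hYd, ← integral_indicator (ℱ.le n _ hA)]
    congr 1
    ext ω
    by_cases hω : ω ∈ A <;> simp [hY, hω]
  have haint : IntegrableOn (fun ω => a ω * L (g n ω) (g (n + 1) ω - g n ω)) A μ := by
    rw [← integrable_indicator_iff (ℱ.le n _ hA)]
    refine hYd.congr (ae_of_all _ fun ω => ?_)
    by_cases hω : ω ∈ A <;> simp [hY, hω]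
  calc ∫ ω in A, azumaExp p C l g v (n + 1) ω ∂μ
      ≤ ∫ ω in A, (azumaExp p C l g v n ω
          + a ω * L (g n ω) (g (n + 1) ω - g n ω)) ∂μ := by
        refine integral_mono_ae (hint _).integrableOn ((hint n).integrableOn.add haint)
          (ae_restrict_of_ae ?_)
        filter_upwards [hd] with ω hω
        exact azumaExp_succ_le hp hC hl hL hup (hω n)
    _ = ∫ ω in A, azumaExp p C l g v n ω ∂μ := by
        rw [integral_add (hint n).integrableOn haint, hYA, add_zero]

end AzumaExp

/-! ### Tail estimates after normalization. -/

section Tail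

theorem sq_le_four_mul_rpow {p x : ℝ} (hp₁ : 1 ≤ p) (hp₂ : p ≤ 2) (hx : 0 ≤ x) (hx4 : x ≤ 4) :
    x ^ 2 ≤ 4 * x ^ p := by
  rcases hx.eq_or_lt' with rfl | h0
  · simp [Real.zero_rpow (by linarith : p ≠ 0)]
  have hxp : 0 < x ^ p := Real.rpow_pos_of_pos h0 p
  rcases le_total x 1 with h | h
  · have : x ^ (2 : ℝ) ≤ x ^ p := Real.rpow_le_rpow_of_exponent_ge h0 h hp₂
    rw [Real.rpow_two] at this
    linarith
  · have := Real.self_le_rpow_of_one_le h hp₁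
    nlinarith

/-- Optimizing the exponential bound: Gaussian decay dominates the decay `exp (-c u ^ p)`. -/
theorem exists_exp_le_two_mul_exp_neg_rpow {p u : ℝ} (hp₂ : p ≤ 2) (hu : 24 ≤ u) :
    ∃ l : ℝ, 0 ≤ l ∧
      Real.exp (11 * l + 16 * l ^ 2 - l * (u - 1)) ≤ 2 * Real.exp (-(u ^ p / 2000)) := by
  -- This l minimizes 16 l² - l(u - 12), with value -(u - 12)²/64; u ≥ 24 gives u - 12 ≥ u/2.
  refine ⟨(u - 12) / 32, by linarith, ?_⟩
  have hup : u ^ p ≤ u ^ 2 := by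
    rw [← Real.rpow_two]
    exact Real.rpow_le_rpow_of_exponent_le (by linarith) hp₂
  have h : Real.exp (11 * ((u - 12) / 32) + 16 * ((u - 12) / 32) ^ 2 - (u - 12) / 32 * (u - 1))
      ≤ Real.exp (-(u ^ p / 2000)) := Real.exp_le_exp.2 (by nlinarith)
  linarith [Real.exp_pos (-(u ^ p / 2000))]

theorem one_le_two_mul_exp_neg_rpow {p u : ℝ} (hp₁ : 1 ≤ p) (hp₂ : p ≤ 2) (hu0 : 0 ≤ u)
    (hu : u ≤ 24) : 1 ≤ 2 * Real.exp (-(u ^ p / 2000)) := by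
  have h1 : u ^ p ≤ 24 ^ (2 : ℝ) :=
    (Real.rpow_le_rpow hu0 hu (by linarith)).trans
      (Real.rpow_le_rpow_of_exponent_le (by norm_num) hp₂)
  have h2 := Real.add_one_le_exp (-(u ^ p / 2000))
  norm_num at h1
  linarith

variable {Ω : Type v} {X : Type u} [NormedAddCommGroup X] [NormedSpace ℝ X] [CompleteSpace X]
  {m : MeasurableSpace Ω} {μ : Measure Ω} [IsProbabilityMeasure μ] {ℱ : Filtration ℕ m}

/-- From s ≥ 1/4 follow 2s + 2 ≤ 10 s, ∑ v^p ≤ 4 and v ≤ 4, so ∑ v² ≤ 16. The compensator is thus at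
most 10 l + 16 l², and the initial value e^l supplies the eleventh l. -/
theorem measureReal_exists_le_norm_le {p s : ℝ} (hp₁ : 1 < p) (hp₂ : p ≤ 2)
    (hs : s ∈ smoothnessBounds X p) (hs4 : 1 / 4 ≤ s)
    {g : ℕ → Ω → X} {v : ℕ → Ω → ℝ} (hg : Martingale g ℱ μ) (hv : IsPredictableSeq ℱ v)
    (hv0 : ∀ j ω, 0 ≤ v (j + 1) ω)
    (h0 : ∀ ω, g 0 ω = 0) (hd : ∀ᵐ ω ∂μ, ∀ j, ‖g (j + 1) ω - g j ω‖ ≤ v (j + 1) ω)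
    (hsum : ∀ᵐ ω ∂μ, ∀ n, s * ∑ j ∈ Finset.range n, v (j + 1) ω ^ p ≤ 1)
    {l : ℝ} (hl : 0 ≤ l) (t : ℝ) (n : ℕ) :
    μ.real {ω | ∃ k ≤ n, t ≤ ‖g k ω‖} ≤ Real.exp (11 * l + 16 * l ^ 2 - l * t) := by
  choose L hL hlow hup using fun x : X => exists_gradient_bounds hp₁.le hp₂ hs x
  have hs0 := hs.1
  have hLc : Continuous L :=
    continuous_of_gradient_bounds hp₁ (by positivity) hL hlow hup
  have hsum4 : ∀ᵐ ω ∂μ, ∀ n, ∑ j ∈ Finset.range n, v (j + 1) ω ^ p ≤ 4 := by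
    filter_upwards [hsum] with ω hω n
    have hS : 0 ≤ ∑ j ∈ Finset.range n, v (j + 1) ω ^ p :=
      Finset.sum_nonneg fun j _ => Real.rpow_nonneg (hv0 j ω) _
    nlinarith [hω n]
  have hB : ∀ᵐ ω ∂μ, ∀ j, v (j + 1) ω ≤ 4 := by
    filter_upwards [hsum4] with ω hω j
    have h₁ : v (j + 1) ω ^ p ≤ 4 :=
      (Finset.single_le_sum (f := fun j => v (j + 1) ω ^ p)
        (fun j _ => Real.rpow_nonneg (hv0 j ω) _) (Finset.self_mem_range_succ j)).trans
        (hω (j + 1))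
    by_contra! h
    have := Real.self_le_rpow_of_one_le (by linarith : 1 ≤ v (j + 1) ω) hp₁.le
    linarith
  have hM := supermartingale_azumaExp hp₁.le (by positivity : 0 ≤ 2 * s + 2) hl hLc hL hup hg
    hv h0 hd hB
  set ε := Real.exp (l * t - 10 * l - 16 * l ^ 2) with hε
  have hmax := hM.mul_measureReal_exists_le_le (fun n ω => (azumaExp_pos ..).le) ε n
  have hint : ∫ ω, azumaExp p (2 * s + 2) l g v 0 ω ∂μ = Real.exp l := by
    simp [azumaExp, h0]
  rw [hint] at hmax
  have hsub : μ.real {ω | ∃ k ≤ n, t ≤ ‖g k ω‖}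
      ≤ μ.real {ω | ∃ k ≤ n, ε ≤ azumaExp p (2 * s + 2) l g v k ω} := by
    refine ENNReal.toReal_mono (measure_ne_top _ _) (measure_mono_ae ?_)
    filter_upwards [hsum, hsum4, hB] with ω h₁ h₂ h₃
    rintro ⟨k, hk, hkt⟩
    refine ⟨k, hk, Real.exp_le_exp.2 ?_⟩
    have h₄ : t ≤ √(1 + ‖g k ω‖ ^ 2) := hkt.trans (Real.le_sqrt_of_sq_le (by linarith))
    have h₅ := mul_le_mul_of_nonneg_left h₄ hl
    have h₆ : ∑ j ∈ Finset.range k, (l * ((2 * s + 2) * v (j + 1) ω ^ p) + l ^ 2 * v (j + 1) ω ^ 2)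
        ≤ ∑ j ∈ Finset.range k, (10 * l * s + 4 * l ^ 2) * v (j + 1) ω ^ p := by
      refine Finset.sum_le_sum fun j _ => ?_
      have e₁ := mul_le_mul_of_nonneg_left
        (sq_le_four_mul_rpow hp₁.le hp₂ (hv0 j ω) (h₃ j)) (sq_nonneg l)
      have e₂ : l * ((2 * s + 2) * v (j + 1) ω ^ p) ≤ l * (10 * s * v (j + 1) ω ^ p) :=
        mul_le_mul_of_nonneg_left
          (mul_le_mul_of_nonneg_right (by linarith) (Real.rpow_nonneg (hv0 j ω) _)) hl
      linarith
    rw [← Finset.mul_sum] at h₆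
    have e₁ := mul_le_mul_of_nonneg_left (h₁ k) hl
    have e₂ := mul_le_mul_of_nonneg_left (h₂ k) (sq_nonneg l)
    linarith
  have hε0 : 0 < ε := Real.exp_pos _
  have hdiv : μ.real {ω | ∃ k ≤ n, t ≤ ‖g k ω‖} ≤ Real.exp l / ε := by
    rw [le_div_iff₀ hε0, mul_comm]
    exact (mul_le_mul_of_nonneg_left hsub hε0.le).trans hmax
  refine hdiv.trans_eq ?_
  rw [hε, ← Real.exp_sub]
  congr 1
  ring

/-- The tail bound for the maximal function, normalized so that `s * ∑ v_j ^ p ≤ 1`. -/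
theorem measure_exists_le_norm_le {p s : ℝ} (hp₁ : 1 < p) (hp₂ : p ≤ 2)
    (hs : s ∈ smoothnessBounds X p) (hs4 : 1 / 4 ≤ s)
    {g : ℕ → Ω → X} {v : ℕ → Ω → ℝ} (hg : Martingale g ℱ μ) (hv : IsPredictableSeq ℱ v)
    (hv0 : ∀ j ω, 0 ≤ v (j + 1) ω)
    (h0 : ∀ ω, g 0 ω = 0) (hd : ∀ᵐ ω ∂μ, ∀ j, ‖g (j + 1) ω - g j ω‖ ≤ v (j + 1) ω)
    (hsum : ∀ᵐ ω ∂μ, ∀ n, s * ∑ j ∈ Finset.range n, v (j + 1) ω ^ p ≤ 1)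
    {u : ℝ} (hu : 0 ≤ u) :
    μ {ω | ∃ k, u - 1 ≤ ‖g k ω‖} ≤ ENNReal.ofReal (2 * Real.exp (-(u ^ p / 2000))) := by
  rcases le_total u 24 with h | h
  · refine prob_le_one.trans ?_
    rw [← ENNReal.ofReal_one]
    exact ENNReal.ofReal_le_ofReal (one_le_two_mul_exp_neg_rpow hp₁.le hp₂ hu h)
  · obtain ⟨l, hl, hle⟩ := exists_exp_le_two_mul_exp_neg_rpow hp₂ h
    have e : {ω | ∃ k, u - 1 ≤ ‖g k ω‖} = ⋃ n, {ω | ∃ k ≤ n, u - 1 ≤ ‖g k ω‖} := by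
      ext ω
      simp only [Set.mem_ofPred_eq, Set.mem_iUnion]
      exact ⟨fun ⟨k, hk⟩ => ⟨k, k, le_rfl, hk⟩, fun ⟨_, k, _, hk⟩ => ⟨k, hk⟩⟩
    have hmono : Monotone fun n => {ω | ∃ k ≤ n, u - 1 ≤ ‖g k ω‖} :=
      fun a b hab ω ⟨k, hk, h⟩ => ⟨k, hk.trans hab, h⟩
    rw [e, hmono.measure_iUnion]
    refine iSup_le fun n => ?_
    rw [← ofReal_measureReal]
    exact ENNReal.ofReal_le_ofReal ((measureReal_exists_le_norm_le hp₁ hp₂ hs hs4 hg hv hv0 h0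
      hd hsum hl (u - 1) n).trans hle)

end Tail

/-! ### Evaluating the bound in [0, ∞]. -/

section Bound

theorem azumaBound_ofReal {p r K b : ℝ} (hr : 0 ≤ r) (hp : 0 ≤ p) (hK : 0 < K) (hb : 0 < b) :
    azumaBound p r K (ENNReal.ofReal b)
      = ENNReal.ofReal (2 * Real.exp (-(r ^ p / (2 * K * b)))) := by
  have e : ENNReal.ofReal r ^ p / (2 * ENNReal.ofReal K * ENNReal.ofReal b)
      = ENNReal.ofReal (r ^ p / (2 * K * b)) := by
    rw [ENNReal.ofReal_div_of_pos (by positivity), ENNReal.ofReal_rpow_of_nonneg hr hp,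
      ENNReal.ofReal_mul (by positivity), ENNReal.ofReal_mul (by positivity), ENNReal.ofReal_ofNat]
  rw [azumaBound, e, EReal.coe_ennreal_ofReal, max_eq_left (by positivity), ← EReal.coe_neg,
    EReal.exp_coe, ENNReal.ofReal_mul zero_le_two, ENNReal.ofReal_ofNat]

theorem azumaBound_top (p r : ℝ) {K : ℝ} (hK : 0 < K) :
    azumaBound p r K ∞ = 2 := by
  have hK' : (2 * ENNReal.ofReal K : ℝ≥0∞) ≠ 0 := by simp [hK]
  simp [azumaBound, ENNReal.mul_top hK']

theorem azumaBound_zero_radius {p : ℝ} (hp : 0 < p) (K : ℝ) (b : ℝ≥0∞) :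
    azumaBound p 0 K b = 2 := by
  simp [azumaBound, ENNReal.zero_rpow_of_pos hp]

end Bound

/-! ### Rescaling and degenerate cases. -/

section Main

variable {Ω : Type v} {m : MeasurableSpace Ω} {μ : Measure Ω} {w : ℕ → Ω → ℝ} {p : ℝ}

theorem ae_tsum_le_powSumNorm (μ : Measure Ω) (p : ℝ) (w : ℕ → Ω → ℝ) :
    ∀ᵐ ω ∂μ, ∑' j : ℕ, ENNReal.ofReal (w (j + 1) ω) ^ p ≤ powSumNorm μ p w := by
  have h := enorm_ae_le_eLpNormEssSup
    (fun ω => ∑' j : ℕ, ENNReal.ofReal (w (j + 1) ω) ^ p) μ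
  simpa only [powSumNorm, eLpNorm_exponent_top, enorm_eq_self] using h

theorem ae_sum_max_rpow_le (hp : 0 ≤ p) {b : ℝ} (hb : 0 ≤ b)
    (h : powSumNorm μ p w ≤ ENNReal.ofReal b) :
    ∀ᵐ ω ∂μ, ∀ n, ∑ j ∈ Finset.range n, max (w (j + 1) ω) 0 ^ p ≤ b := by
  filter_upwards [ae_tsum_le_powSumNorm μ p w] with ω hω n
  rw [← ENNReal.ofReal_le_ofReal_iff hb,
    ENNReal.ofReal_sum_of_nonneg fun j _ => Real.rpow_nonneg (le_max_right _ _) p]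
  refine le_trans ?_ ((ENNReal.sum_le_tsum (Finset.range n)).trans (hω.trans h))
  refine Finset.sum_le_sum fun j _ => ?_
  rw [← ENNReal.ofReal_rpow_of_nonneg (le_max_right _ _) hp]
  simp

variable {X : Type u} [NormedAddCommGroup X]

theorem maximalFn_ae_eq_zero {f : ℕ → Ω → X} (hp : 0 < p) (hw : powSumNorm μ p w = 0)
    (hd : ∀ᵐ ω ∂μ, ∀ j, ‖f (j + 1) ω - f j ω‖ ≤ w (j + 1) ω) :
    ∀ᵐ ω ∂μ, maximalFn f ω = 0 := by
  filter_upwards [ae_tsum_le_powSumNorm μ p w, hd] with ω h₁ h₂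
  rw [hw, nonpos_iff_eq_zero, ENNReal.tsum_eq_zero] at h₁
  have hstep : ∀ j, f (j + 1) ω = f j ω := fun j => by
    have h₃ := (ENNReal.rpow_eq_zero_iff_of_pos hp).1 (h₁ j)
    exact sub_eq_zero.1 (norm_le_zero_iff.1 ((h₂ j).trans (ENNReal.ofReal_eq_zero.1 h₃)))
  have hall : ∀ j, f j ω = f 0 ω := fun j => by
    induction j with
    | zero => rfl
    | succ j ih => rw [hstep, ih]
  simp [maximalFn, hall]

theorem exists_le_norm_of_le_maximalFn {f : ℕ → Ω → X} {ω : Ω} {r t : ℝ} (hr : 0 < r) (htr : t < r)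
    (h : ENNReal.ofReal r ≤ maximalFn f ω) : ∃ j, t ≤ ‖f j ω - f 0 ω‖ := by
  have hlt : ENNReal.ofReal t < maximalFn f ω :=
    ((ENNReal.ofReal_lt_ofReal_iff hr).2 htr).trans_le h
  obtain ⟨j, hj⟩ := lt_iSup_iff.1 hlt
  refine ⟨j + 1, ?_⟩
  rw [← ofReal_norm] at hj
  exact (ENNReal.ofReal_lt_ofReal_iff'.1 hj).1.le

variable [NormedSpace ℝ X] [CompleteSpace X] [IsProbabilityMeasure μ] {ℱ : Filtration ℕ m}

theorem measure_le_maximalFn_le {s : ℝ} (hp₁ : 1 < p) (hp₂ : p ≤ 2)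
    (hs : s ∈ smoothnessBounds X p) (hs4 : 1 / 4 ≤ s) {f : ℕ → Ω → X}
    (hf : Martingale f ℱ μ) (hw : IsPredictableSeq ℱ w)
    (hd : ∀ᵐ ω ∂μ, ∀ j, ‖f (j + 1) ω - f j ω‖ ≤ w (j + 1) ω)
    {b : ℝ} (hb : 0 < b) (hwb : powSumNorm μ p w ≤ ENNReal.ofReal b) {r : ℝ} (hr : 0 < r) :
    μ {ω | ENNReal.ofReal r ≤ maximalFn f ω}
      ≤ ENNReal.ofReal (2 * Real.exp (-(r ^ p / (2 * (1000 * s) * b)))) := by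
  have hs0 := hs.1
  have hsb : 0 < s * b := by positivity
  -- Dividing by a normalizes s ∑ v^p ≤ 1 and turns (r / a)^p / 2000 into the target exponent with K
  -- = 1000 s.
  set a : ℝ := (s * b) ^ p⁻¹ with ha
  have ha0 : 0 < a := Real.rpow_pos_of_pos hsb _
  have hap : a ^ p = s * b := Real.rpow_inv_rpow hsb.le (by linarith)
  set g : ℕ → Ω → X := a⁻¹ • (f - fun _ => f 0) with hg
  set v : ℕ → Ω → ℝ := fun j ω => a⁻¹ * max (w j ω) 0 with hv
  have hgm : Martingale g ℱ μ :=
    (hf.sub (martingale_const_fun ℱ μ (hf.1 0) (hf.integrable 0))).smul a⁻¹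
  have hvp : IsPredictableSeq ℱ v := fun j => ((hw j).max measurable_const).const_mul _
  have hv0 : ∀ j ω, 0 ≤ v (j + 1) ω := fun j ω => by positivity
  have hgapp : ∀ j ω, g j ω = a⁻¹ • (f j ω - f 0 ω) := fun j ω => rfl
  have hgd : ∀ᵐ ω ∂μ, ∀ j, ‖g (j + 1) ω - g j ω‖ ≤ v (j + 1) ω := by
    filter_upwards [hd] with ω hω j
    rw [hgapp, hgapp, ← smul_sub, sub_sub_sub_cancel_right, norm_smul,
      Real.norm_of_nonneg (by positivity)]
    exact mul_le_mul_of_nonneg_left ((hω j).trans (le_max_left _ _)) (by positivity)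
  have hsum : ∀ᵐ ω ∂μ, ∀ n, s * ∑ j ∈ Finset.range n, v (j + 1) ω ^ p ≤ 1 := by
    filter_upwards [ae_sum_max_rpow_le (by linarith) hb.le hwb] with ω hω n
    have e : ∀ j, v (j + 1) ω ^ p = (s * b)⁻¹ * max (w (j + 1) ω) 0 ^ p := fun j => by
      rw [hv, Real.mul_rpow (by positivity) (le_max_right _ _), Real.inv_rpow ha0.le, hap]
    simp_rw [e]
    rw [← Finset.mul_sum]
    calc s * ((s * b)⁻¹ * ∑ j ∈ Finset.range n, max (w (j + 1) ω) 0 ^ p)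
        ≤ s * ((s * b)⁻¹ * b) := by gcongr; exact hω n
      _ = 1 := by field_simp
  have hmain := measure_exists_le_norm_le hp₁ hp₂ hs hs4 hgm hvp hv0 (fun ω => by simp [hgapp])
    hgd hsum (by positivity : 0 ≤ r / a)
  have e : (r / a) ^ p / 2000 = r ^ p / (2 * (1000 * s) * b) := by
    rw [Real.div_rpow hr.le ha0.le, hap]
    field_simp
    norm_num
  rw [e] at hmain
  refine (measure_mono fun ω hω => ?_).trans hmain
  -- The supremum need not be attained; the loss of a in radius is the loss of 1 in u - 1 after
  -- scaling.
  obtain ⟨j, hj⟩ := exists_le_norm_of_le_maximalFn hr (by linarith : r - a < r) hω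
  refine ⟨j, ?_⟩
  rw [hgapp, norm_smul, Real.norm_of_nonneg (by positivity), inv_mul_eq_div, le_div_iff₀ ha0,
    sub_mul, div_mul_cancel₀ _ ha0.ne', one_mul]
  exact hj

end Main

theorem mainTheorem1 :
    ∃ D : ℝ, 0 < D ∧
      ∀ (X : Type u) [NormedAddCommGroup X] [NormedSpace ℝ X] [CompleteSpace X] [Nontrivial X]
        (p : ℝ), 1 < p → p ≤ 2 → IsUniformlySmooth X p →
        ∃ K : ℝ, 0 < K ∧ K ≤ D * smoothnessConstant X p ∧
          ∀ (Ω : Type v) (m : MeasurableSpace Ω) (μ : Measure Ω) [IsProbabilityMeasure μ]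
            (ℱ : Filtration ℕ m) (f : ℕ → Ω → X) (w : ℕ → Ω → ℝ),
            Martingale f ℱ μ →
            IsPredictableSeq ℱ w →
            (∀ j : ℕ, ∀ᵐ ω ∂μ, 0 ≤ w (j + 1) ω) →
            (∀ j : ℕ, ∀ᵐ ω ∂μ, ‖f (j + 1) ω - f j ω‖ ≤ w (j + 1) ω) →
            ∀ r : ℝ, 0 ≤ r →
              μ {ω | ENNReal.ofReal r ≤ maximalFn f ω} ≤
                azumaBound p r K (powSumNorm μ p w) := by
  refine ⟨1000, by norm_num, fun X _ _ _ _ p hp₁ hp₂ hX => ?_⟩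
  have hs := smoothnessConstant_mem hp₂ hX
  have hs4 := quarter_le_of_mem_smoothnessBounds hp₂ hs
  set s := smoothnessConstant X p
  have hK : 0 < 1000 * s := by linarith
  refine ⟨1000 * s, hK, le_rfl, fun Ω m μ _ ℱ f w hf hw _ hd r hr => ?_⟩
  have hd' := ae_all_iff.2 hd
  rcases hr.eq_or_lt with rfl | hr0
  · rw [azumaBound_zero_radius (by linarith)]
    exact prob_le_one.trans one_le_two
  rcases eq_or_ne (powSumNorm μ p w) ∞ with htop | htop
  · rw [htop, azumaBound_top p r hK]
    exact prob_le_one.trans one_le_two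
  rcases eq_or_ne (powSumNorm μ p w) 0 with hzero | hzero
  · have h0 : μ {ω | ENNReal.ofReal r ≤ maximalFn f ω} = 0 := by
      refine measure_eq_zero_iff_ae_notMem.2 ?_
      filter_upwards [maximalFn_ae_eq_zero (by linarith) hzero hd'] with ω hω
      simp [hω, hr0]
    rw [h0]
    exact zero_le
  · have hb := ENNReal.toReal_pos hzero htop
    have e := (ENNReal.ofReal_toReal htop).symm
    rw [e, azumaBound_ofReal hr (by linarith) hK hb]
    exact measure_le_maximalFn_le hp₁ hp₂ hs hs4 hf hw hd' hb e.le hr0
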